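/- **Proposition 3.1.** Let $\Omega$ be a finite set of cardinality $d\ge 3$, and let $T_d$ be a $d$-regular tree with vertex set $V_d$ and edge set $E_d$, equipped with a coloring $c:E_d\to\Omega$ that restricts to a bijection between the star around $v$ and $\Omega$ for every vertex $v$. For $g\in\mathrm{Aut}(T_d)$ and $v\in V_d$ let $\sigma(g,v)\in\mathrm{Sym}(\Omega)$ be the local permutation of $g$ at $v$, i.e. $\sigma(g,v)$ sends the color of an edge $e$ at $v$ to the color of $ge$. Let $F\le F'\le \mathrm{Sym}(\Omega)$ be permutation groups such that $F'$ preserves the orbits of $F$ and $F$ is semi-regular (trivial point stabilizers), and let $n=[F':F]$. Let $$G(F,F')=\{g\in \mathrm{Aut}(T_d) : \sigma(g,v)\in F' \text{ for all } v,\ \sigma(g,v)\in F \text{ for all but finitely many } v\},$$ fix $v_0\in V_d$, and let $K(F,F')$ be the stabilizer of $v_0$ in $G(F,F')$. Let $\mathfrak S_n$ be the symmetric group of $\Sigma_n=\{0,\dots,n-1\}$, let $\mathfrak S_{n-1}\le\mathfrak S_n$ be the stabilizer of $0$, and let $\mathfrak S_n^{V_d,\mathfrak S_{n-1}}$ be the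 group of functions $V_d\to\mathfrak S_n$ taking values in $\mathfrak S_{n-1}$ outside a finite set. Put $G_{n,d}=\mathfrak S_n^{V_d,\mathfrak S_{n-1}}\rtimes \mathrm{Aut}(T_d)$, where $(\gamma f)(v)=f(\gamma^{-1}v)$, with the topology in which the sets $(\sigma U_1,\gamma U_2)$ form a basis of neighbourhoods of $(\sigma,\gamma)$, for $U_1$, $U_2$ in a basis of neighbourhoods of the identity in $\mathfrak S_{n-1}^{V_d}$ (product topology) and in $\mathrm{Aut}(T_d)$ (pointwise convergence) respectively. Let $H_{n,d}=\mathfrak S_n^{V_d,\mathfrak S_{n-1}}\rtimes K_d$, where $K_d$ is the stabilizer of $v_0$ in $\mathrm{Aut}(T_d)$, with the induced topology. Then $H_{n,d}$ is a (Hausdorff) locally compact group, open in $G_{n,d}$, and the group $K(F,F')$ embeds as a cocompact lattice in $H_{n,d}$, that is, as a discrete subgroup $\Gamma$ such that $H_{n,d}/\Gamma$ is compact and carries a non-zero finite $H_{n,d}$-invariant Borel measure. More precisely, there exist bijections $\Sigma_n\to F'/F$ sending $0$ to the class $F$. Fix any of them, let $\alpha:F'\to\mathfrak S_n$ be the homomorphism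 induced by the action of $F'$ on $F'/F$, and let $\varphi:G(F,F')\to G_{n,d}$ be the homomorphism $\varphi(\gamma)=(\rho_\gamma,\gamma)$ with $\rho_{\gamma,v}=\alpha(\sigma(\gamma,\gamma^{-1}v))$. Then $\varphi$ restricts to an injective homomorphism $K(F,F')\to H_{n,d}$ whose image is $\varphi(G(F,F'))\cap H_{n,d}$, and this image is a cocompact lattice in $H_{n,d}$. -/

import Mathlib

namespace TreeLattice

/-! ### Semi-restricted permutational wreath products -/

/-- `B^{X,A}`: the functions `X → B` with values in `A` outside a finite set. -/
def semiRestricted (X : Type*) {B : Type*} [Group B] (A : Subgroup B) : Subgroup (X → B) where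
  carrier := {f | {x | f x ∉ A}.Finite}
  one_mem' := by simp [A.one_mem]
  mul_mem' := by
    intro f g hf hg
    refine (Set.Finite.union hf hg).subset fun x hx => ?_
    by_contra h
    simp only [Set.mem_union, Set.mem_ofPred_eq, not_or, not_not] at h
    exact hx (A.mul_mem h.1 h.2)
  inv_mem' := by
    intro f hf
    simpa using hf

/-- An action of `H` on `X` induces the action `(h f)(x) = f (h⁻¹ x)` of `H` on `B^{X,A}`
by group automorphisms. -/
def shift (X : Type*) {B : Type*} [Group B] (A : Subgroup B) (H : Type*) [Group H]
    [MulAction H X] : H →* MulAut (semiRestricted X A) where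
  toFun h :=
    { toFun := fun f => ⟨fun x => f.1 (h⁻¹ • x), by
        have := f.2.preimage (MulAction.injective h⁻¹).injOn
        exact this⟩
      invFun := fun f => ⟨fun x => f.1 (h • x), by
        have := f.2.preimage (MulAction.injective h).injOn
        exact this⟩
      left_inv := fun f => by ext x; simp
      right_inv := fun f => by ext x; simp
      map_mul' := fun f g => rfl }
  map_one' := by ext f x; simp
  map_mul' h k := by ext f x; simp [mul_smul]

/-- The semi-restricted permutational wreath product `B ≀_X^A H = B^{X,A} ⋊ H`. -/
abbrev SemiRestrictedWreath (X : Type*) {B : Type*} [Group B] (A : Subgroup B) (H : Type*)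
    [Group H] [MulAction H X] : Type _ :=
  semiRestricted X A ⋊[shift X A H] H

/-- The topology on `B^{X,A}` for a finite discrete group `B`. A basis of neighbourhoods of `σ` is
given by the sets `σ U`, where `U` runs over the basis of neighbourhoods of the identity of the
compact group `A^X` (product topology) made of the
`U_I = {u ∈ A^X | u v = 1 for all v ∈ I}` with `I ⊆ X` finite. -/
instance semiRestrictedTopology (X : Type*) {B : Type*} [Group B] (A : Subgroup B) :
    TopologicalSpace (semiRestricted X A) where
  IsOpen s := ∀ σ ∈ s, ∃ I : Finset X, ∀ τ : semiRestricted X A,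
    (∀ x, (σ.1 x)⁻¹ * τ.1 x ∈ A) → (∀ x ∈ I, (σ.1 x)⁻¹ * τ.1 x = 1) → τ ∈ s
  isOpen_univ := fun _ _ => ⟨∅, fun _ _ _ => trivial⟩
  isOpen_inter := by
    classical
    intro s t hs ht σ hσ
    obtain ⟨I, hI⟩ := hs σ hσ.1
    obtain ⟨J, hJ⟩ := ht σ hσ.2
    exact ⟨I ∪ J, fun τ h1 h2 =>
      ⟨hI τ h1 fun x hx => h2 x (Finset.mem_union_left _ hx),
        hJ τ h1 fun x hx => h2 x (Finset.mem_union_right _ hx)⟩⟩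
  isOpen_sUnion := by
    intro S hS σ hσ
    obtain ⟨s, hs, hσs⟩ := hσ
    obtain ⟨I, hI⟩ := hS s hs σ hσs
    exact ⟨I, fun τ h1 h2 => ⟨s, hs, hI τ h1 h2⟩⟩

/-- The topology on `B ≀_X^A H`: as a topological space it is the product `B^{X,A} × H`. -/
instance wreathTopology (X : Type*) {B : Type*} [Group B] (A : Subgroup B) (H : Type*)
    [Group H] [MulAction H X] [TopologicalSpace H] :
    TopologicalSpace (SemiRestrictedWreath X A H) :=
  TopologicalSpace.induced (fun g => (g.left, g.right)) instTopologicalSpaceProd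

/-! ### Cocompact lattices -/

/-- A cocompact lattice of the topological group `G`: a discrete subgroup `Γ` such that `G ⧸ Γ`
is compact and carries a non-zero finite `G`-invariant Borel measure. -/
structure IsCocompactLattice {G : Type*} [Group G] [TopologicalSpace G] (Γ : Subgroup G) :
    Prop where
  discrete : DiscreteTopology Γ
  finite_covolume : letI : MeasurableSpace (G ⧸ Γ) := borel (G ⧸ Γ)
    ∃ μ : MeasureTheory.Measure (G ⧸ Γ), MeasureTheory.IsFiniteMeasure μ ∧ μ ≠ 0 ∧
      ∀ (g : G) (s : Set (G ⧸ Γ)), MeasurableSet s → μ ((fun x => g • x) ⁻¹' s) = μ s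
  cocompact : CompactSpace (G ⧸ Γ)

/-! ### Permutation groups -/

/-- A permutation group is semi-regular if its point stabilizers are trivial. -/
def IsSemiregular {Ω : Type*} (F : Subgroup (Equiv.Perm Ω)) : Prop :=
  ∀ s ∈ F, ∀ a, s a = a → s = 1

/-- `F'` preserves each `F`-orbit in `Ω`. -/
def PreservesOrbits {Ω : Type*} (F F' : Subgroup (Equiv.Perm Ω)) : Prop :=
  ∀ s ∈ F', ∀ a, s a ∈ MulAction.orbit F a

/-! ### Groups acting on trees with almost prescribed local action -/

/-- An edge coloring of `T` by `Ω` that restricts, around each vertex `v`, to a bijection between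
the star of `v` (whose edges are the `{v, w}` with `w` a neighbour of `v`) and `Ω`. -/
structure LegalColoring {V : Type*} (T : SimpleGraph V) (Ω : Type*) where
  color : T.edgeSet → Ω
  bijective_star : ∀ v, Function.Bijective fun w : T.neighborSet v => color ⟨s(v, w.1), w.2⟩

section

variable {V : Type*} {T : SimpleGraph V} {Ω : Type*} (c : LegalColoring T Ω)

/-- The bijection between the star around `v` and `Ω` given by the coloring. -/
noncomputable def LegalColoring.star (v : V) : T.neighborSet v ≃ Ω :=
  Equiv.ofBijective _ (c.bijective_star v)

/-- The local permutation `σ(g, v)`: it sends the color of an edge at `v` to the color of its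
image by `g`. -/
noncomputable def localPerm (g : T ≃g T) (v : V) : Equiv.Perm Ω :=
  (c.star v).symm.trans ((g.mapNeighborSet v).trans (c.star (g v)))

theorem localPerm_one (v : V) : localPerm c 1 v = 1 := by
  ext a
  exact (c.star v).apply_symm_apply a

theorem localPerm_mul (g h : T ≃g T) (v : V) :
    localPerm c (g * h) v = localPerm c g (h v) * localPerm c h v := by
  ext a
  simp only [localPerm, Equiv.trans_apply, Equiv.Perm.mul_apply, Equiv.symm_apply_apply]
  rfl

theorem localPerm_inv (g : T ≃g T) (v : V) :
    localPerm c g⁻¹ v = (localPerm c g (g⁻¹ v))⁻¹ := by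
  rw [eq_inv_iff_mul_eq_one, ← localPerm_one c v, ← inv_mul_cancel g]
  have h := localPerm_mul c g g⁻¹ v
  rw [mul_inv_cancel, localPerm_one] at h
  rw [inv_mul_cancel, localPerm_one]
  exact mul_eq_one_comm.mp h.symm

/-- `G(F,F')`: the automorphisms of `T` all of whose local permutations are in `F'` and all but
finitely many of whose local permutations are in `F`. -/
def almostPrescribed (F F' : Subgroup (Equiv.Perm Ω)) : Subgroup (T ≃g T) where
  carrier := {g | (∀ v, localPerm c g v ∈ F') ∧ {v | localPerm c g v ∉ F}.Finite}
  one_mem' := by simp [localPerm_one, F.one_mem, F'.one_mem]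
  mul_mem' := by
    rintro g h ⟨hg, hg'⟩ ⟨hh, hh'⟩
    refine ⟨fun v => localPerm_mul c g h v ▸ F'.mul_mem (hg _) (hh _), ?_⟩
    refine ((hg'.preimage (h.injective.injOn)).union hh').subset fun v hv => ?_
    by_contra hcon
    simp only [Set.mem_union, Set.mem_preimage, Set.mem_ofPred_eq, not_or, not_not] at hcon
    exact hv (localPerm_mul c g h v ▸ F.mul_mem hcon.1 hcon.2)
  inv_mem' := by
    rintro g ⟨hg, hg'⟩
    refine ⟨fun v => localPerm_inv c g v ▸ F'.inv_mem (hg _), ?_⟩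
    refine (hg'.preimage ((g⁻¹).injective.injOn)).subset fun v hv hmem => hv ?_
    exact localPerm_inv c g v ▸ F.inv_mem hmem

/-- `K(F,F')`: the stabilizer of `v₀` in `G(F,F')`. -/
def vertexStabilizer (v₀ : V) (F F' : Subgroup (Equiv.Perm Ω)) :
    Subgroup (almostPrescribed c F F') :=
  MulAction.stabilizer (almostPrescribed c F F') v₀

end

/-- The topology of pointwise convergence on `Aut(T)`, for the discrete topology on `V`. -/
instance autTopology {V : Type*} (T : SimpleGraph V) : TopologicalSpace (T ≃g T) :=
  TopologicalSpace.induced (fun (g : T ≃g T) (v : V) => g v)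
    (@Pi.topologicalSpace V (fun _ => V) fun _ => ⊥)

/-! ### The groups `G_{n,d}` and `H_{n,d}` -/

/-- The subgroup `𝔖_{n-1}` of `𝔖_n`: the stabilizer of `0 ∈ Σ_n = {0, …, n-1}`. -/
def pointStab (n : ℕ) [NeZero n] : Subgroup (Equiv.Perm (Fin n)) :=
  MulAction.stabilizer (Equiv.Perm (Fin n)) (0 : Fin n)

/-- `G_{n,d} = 𝔖_n ≀_{V}^{𝔖_{n-1}} Aut(T)`. -/
abbrev Gnd {V : Type*} (T : SimpleGraph V) (n : ℕ) [NeZero n] : Type _ :=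
  SemiRestrictedWreath V (pointStab n) (T ≃g T)

/-- `H_{n,d} = 𝔖_n^{V, 𝔖_{n-1}} ⋊ K_d`, as a subgroup of `G_{n,d}`: the stabilizer of the
vertex `v₀` for the action on `T` through the projection to `Aut(T)`. -/
def Hnd {V : Type*} (T : SimpleGraph V) (n : ℕ) [NeZero n] (v₀ : V) : Subgroup (Gnd T n) :=
  (MulAction.stabilizer (T ≃g T) v₀).comap SemidirectProduct.rightHom

/-! ### The embedding -/

section

variable {Ω : Type*} {F F' : Subgroup (Equiv.Perm Ω)} {n : ℕ}

/-- The homomorphism `α : F' → 𝔖_n` given by the action of `F'` on `F' ⧸ F` by left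
multiplication, once a bijection `b` between `Σ_n` and `F' ⧸ F` is fixed. -/
def cosetAction (b : Fin n ≃ F' ⧸ F.subgroupOf F') : F' →* Equiv.Perm (Fin n) :=
  (b.symm.permCongrHom.toMonoidHom).comp (MulAction.toPermHom F' (F' ⧸ F.subgroupOf F'))

theorem cosetAction_apply (b : Fin n ≃ F' ⧸ F.subgroupOf F') (s : F') (i : Fin n) :
    cosetAction b s i = b.symm (s • b i) := rfl

theorem cosetAction_mem_pointStab [NeZero n] (b : Fin n ≃ F' ⧸ F.subgroupOf F')
    (hb : b 0 = ((1 : F') : F' ⧸ F.subgroupOf F')) (s : F') :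
    cosetAction b s ∈ pointStab n ↔ (s : Equiv.Perm Ω) ∈ F := by
  rw [pointStab, MulAction.mem_stabilizer_iff, Equiv.Perm.smul_def, cosetAction_apply,
    Equiv.symm_apply_eq, hb, MulAction.Quotient.smul_coe, smul_eq_mul, mul_one, eq_comm,
    QuotientGroup.eq, inv_one, one_mul, Subgroup.mem_subgroupOf]

variable {V : Type*} {T : SimpleGraph V} (c : LegalColoring T Ω)

/-- `ρ_γ = (α(σ(γ, γ⁻¹ v)))_v`. -/
noncomputable def twist (b : Fin n ≃ F' ⧸ F.subgroupOf F') (γ : almostPrescribed c F F') (v : V) :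
    Equiv.Perm (Fin n) :=
  cosetAction b ⟨localPerm c γ.1 (γ.1⁻¹ v), γ.2.1 _⟩

/-- The morphism `φ : G(F,F') → G_{n,d}`, `γ ↦ (ρ_γ, γ)`. -/
noncomputable def embedding [NeZero n] (b : Fin n ≃ F' ⧸ F.subgroupOf F')
    (hb : b 0 = ((1 : F') : F' ⧸ F.subgroupOf F')) : almostPrescribed c F F' →* Gnd T n where
  toFun γ := ⟨⟨twist c b γ, by
    refine (γ.2.2.preimage ((γ.1⁻¹).injective.injOn)).subset fun v hv hmem => hv ?_
    exact (cosetAction_mem_pointStab b hb _).2 hmem⟩, γ.1⟩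
  map_one' := by
    ext v : 3
    · refine (congrArg (cosetAction b) (Subtype.ext ?_)).trans (map_one (cosetAction b))
      exact localPerm_one c _
    · rfl
  map_mul' γ δ := by
    ext v : 3
    · refine (congrArg (cosetAction b) (Subtype.ext ?_)).trans (map_mul (cosetAction b) _ _)
      have h := localPerm_mul c γ.1 δ.1 ((γ.1 * δ.1)⁻¹ v)
      have h2 : δ.1 ((γ.1 * δ.1)⁻¹ v) = γ.1⁻¹ v := by
        rw [mul_inv_rev]
        exact δ.1.apply_symm_apply _
      rw [h2] at h
      refine h.trans ?_
      rw [mul_inv_rev]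
      rfl
    · rfl

/-- The restriction of `φ` to a morphism `K(F,F') → H_{n,d}`. -/
noncomputable def stabilizerEmbedding [NeZero n] (v₀ : V) (b : Fin n ≃ F' ⧸ F.subgroupOf F')
    (hb : b 0 = ((1 : F') : F' ⧸ F.subgroupOf F')) :
    vertexStabilizer c v₀ F F' →* Hnd T n v₀ :=
  ((embedding c b hb).comp (vertexStabilizer c v₀ F F').subtype).codRestrict (Hnd T n v₀)
    fun γ => γ.2

end

end TreeLattice

/-!
The group `H = H_{n,d}` contains the compact open subgroup `O = 𝔖_{n-1}^V ⋊ K_d`, and the image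
`Γ` of `K(F,F')` meets `O` in elements all of whose local permutations are in `F`. Since `F` is
semi-regular, such an automorphism is trivial as soon as it fixes `v₀` and its neighbours
(`eq_one_of_localPerm_mem`), so `Γ` is discrete (`discreteTopology_range`).

Cocompactness is the equality `H = O Γ` (`exists_mul_mem_levelSubgroup`). It amounts to finding a
`δ` in `K(F,F')` whose local permutations lie in prescribed cosets `F s_v` in `F'`. This `δ` is
built outward from `v₀` (`exists_iso_localPerm`): the local permutation at a new vertex also has
to take a prescribed value at the color of the edge to the parent, and an element of `F s_v` does
so since `F'` preserves the orbits of `F`. A map obtained in this way is locally bijective, and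
therefore an automorphism of the tree (`exists_iso_of_local`).

The invariant measure on `H ⧸ Γ` is the image of a Haar measure of `H` restricted to `O`. It is
invariant because `H = O Γ` and because the Haar measure is also right invariant, as `H` is a
union of compact open subgroups: those made of the `(σ, γ)` with `σ` in `𝔖_{n-1}` outside a
finite `K_d`-invariant set of vertices (`isCocompactLattice_of_mul_eq_univ`,
`exists_levelSubgroup_mem`).
-/

namespace TreeLattice

/-! ### Automorphisms of a tree with prescribed local action -/

section Tree

variable {V : Type*} {T : SimpleGraph V}

/-- On a rooted tree, functions can be defined by recursion from each vertex to its neighbours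
farther from the root. -/
theorem exists_rec_dist {α : Type*} (v₀ : V) (par : V → V)
    (hpar : ∀ v, v ≠ v₀ → T.dist v₀ (par v) + 1 = T.dist v₀ v)
    (a₀ : α) (step : V → α → α) :
    ∃ f : V → α, f v₀ = a₀ ∧ ∀ v, v ≠ v₀ → f v = step v (f (par v)) := by
  let G : ℕ → V → α := fun k => Nat.rec (fun _ => a₀) (fun _ g v => step v (g (par v))) k
  refine ⟨fun v => G (T.dist v₀ v) v, by simp [G], fun v hv => ?_⟩
  have h := hpar v hv
  simp only [← h]
  rfl

theorem exists_parent (hT : T.Connected) (v₀ : V) :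
    ∃ par : V → V, ∀ v, v ≠ v₀ → T.Adj v (par v) ∧ T.dist v₀ (par v) + 1 = T.dist v₀ v := by
  have key : ∀ v, ∃ w, v ≠ v₀ → T.Adj v w ∧ T.dist v₀ w + 1 = T.dist v₀ v := by
    intro v
    by_cases hv : v = v₀
    · exact ⟨v, fun h => absurd hv h⟩
    obtain ⟨p, hp⟩ := hT.exists_walk_length_eq_dist v v₀
    cases p with
    | nil => exact absurd rfl hv
    | @cons _ w _ h q =>
      refine ⟨w, fun _ => ⟨h, ?_⟩⟩
      rw [SimpleGraph.Walk.length_cons] at hp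
      have h1 := SimpleGraph.dist_le q
      have h2 := hT.dist_triangle (u := v) (v := w) (w := v₀)
      rw [SimpleGraph.dist_eq_one_iff_adj.2 h] at h2
      rw [SimpleGraph.dist_comm (u := v₀) (v := w), SimpleGraph.dist_comm (u := v₀) (v := v)]
      omega
  choose par hp using key
  exact ⟨par, hp⟩

/-- In a tree, a vertex has at most one neighbour closer to a given root. -/
theorem neighbor_closer_unique (hT : T.IsTree) (v₀ : V) {v w w' : V} (h : T.Adj v w)
    (h' : T.Adj v w') (hd : T.dist v₀ w + 1 = T.dist v₀ v)
    (hd' : T.dist v₀ w' + 1 = T.dist v₀ v) : w = w' := by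
  obtain ⟨p, hp⟩ := hT.connected.exists_walk_length_eq_dist v₀ w
  obtain ⟨p', hp'⟩ := hT.connected.exists_walk_length_eq_dist v₀ w'
  have h1 : (p.concat h.symm).IsPath := SimpleGraph.Walk.isPath_of_length_eq_dist _ (by
    rw [SimpleGraph.Walk.length_concat, hp, hd])
  have h2 : (p'.concat h'.symm).IsPath := SimpleGraph.Walk.isPath_of_length_eq_dist _ (by
    rw [SimpleGraph.Walk.length_concat, hp', hd'])
  have h3 : p.concat h.symm = p'.concat h'.symm :=
    congrArg Subtype.val
      ((hT.isAcyclic.subsingleton_path _ _).elim (⟨_, h1⟩ : T.Path _ _) ⟨_, h2⟩)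
  have h4 := congrArg SimpleGraph.Walk.penultimate h3
  simpa using h4

/-- A property of edges of a rooted tree that holds, in both orientations, for the edges from a
vertex to its parent holds for all edges. -/
theorem adj_induction (hT : T.IsTree) (v₀ : V) (par : V → V)
    (hpar : ∀ v, v ≠ v₀ → T.Adj v (par v) ∧ T.dist v₀ (par v) + 1 = T.dist v₀ v)
    {P : V → V → Prop} (hP : ∀ v, v ≠ v₀ → P v (par v) ∧ P (par v) v) {v w : V}
    (h : T.Adj v w) : P v w := by
  have hne : ∀ {v w : V}, T.dist v₀ v = T.dist v₀ w + 1 → v ≠ v₀ := by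
    rintro v w h rfl
    simp at h
  rcases hT.dist_eq_dist_add_one_of_adj v₀ h with h1 | h1
  · have hv := hne h1
    rw [neighbor_closer_unique hT v₀ h (hpar v hv).1 h1.symm (hpar v hv).2]
    exact (hP v hv).1
  · have hw := hne h1
    rw [neighbor_closer_unique hT v₀ h.symm (hpar w hw).1 h1.symm (hpar w hw).2]
    exact (hP w hw).2

/-- A morphism from an arbitrary graph to a forest that is injective on stars sends walks without
backtracking to walks without backtracking, and these are paths. -/
theorem injective_of_locally_injective {W : Type*} {S : SimpleGraph W} (hT : T.IsAcyclic)
    (hS : S.Connected) (f : S →g T)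
    (hf : ∀ v w w', S.Adj v w → S.Adj v w' → f w = f w' → w = w') : Function.Injective f := by
  classical
  intro u v huv
  obtain ⟨p, hp⟩ := (hS.exists_isPath u v)
  have hchain : List.IsChain (· ≠ ·) (p.map f).edges := by
    have key : ∀ {u v : W} (p : S.Walk u v), p.IsPath →
        List.IsChain (· ≠ ·) (p.map f).edges := by
      intro u v p
      induction p with
      | nil => intro _; simp
      | @cons a b d h q ih =>
        intro hq
        have ih' := ih hq.of_cons
        cases q with
        | nil => simp
        | @cons _ e _ h' r =>
          simp only [SimpleGraph.Walk.map_cons, SimpleGraph.Walk.edges_cons] at ih' ⊢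
          refine List.isChain_cons_cons.2 ⟨fun he => ?_, ih'⟩
          have hae : f a = f e := by
            rw [Sym2.eq_iff] at he
            rcases he with ⟨h1, _⟩ | ⟨h1, _⟩
            · exact absurd h1 (f.map_adj h).ne
            · exact h1
          have := hf b a e h.symm h' hae
          subst this
          rw [SimpleGraph.Walk.cons_isPath_iff] at hq
          simp at hq
    exact key p hp
  have hpath := (hT.isPath_iff_isChain _).2 hchain
  cases p with
  | nil => rfl
  | cons h q =>
    exfalso
    rw [SimpleGraph.Walk.map_cons, SimpleGraph.Walk.cons_isPath_iff] at hpath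
    exact hpath.2 (by rw [huv]; exact SimpleGraph.Walk.end_mem_support _)

variable {Ω : Type*} (c : LegalColoring T Ω)

/-- The neighbour of `v` along the edge of color `a`. -/
noncomputable def LegalColoring.next (v : V) (a : Ω) : V := ((c.star v).symm a).1

/-- The color of the edge between two adjacent vertices. -/
def LegalColoring.edgeColor {v w : V} (h : T.Adj v w) : Ω := c.color ⟨s(v, w), h⟩

theorem LegalColoring.adj_next (v : V) (a : Ω) : T.Adj v (c.next v a) := ((c.star v).symm a).2

theorem LegalColoring.edgeColor_symm {v w : V} (h : T.Adj v w) :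
    c.edgeColor h.symm = c.edgeColor h :=
  congrArg c.color (Subtype.ext Sym2.eq_swap)

theorem LegalColoring.edgeColor_next (v : V) (a : Ω) : c.edgeColor (c.adj_next v a) = a :=
  (c.star v).apply_symm_apply a

theorem LegalColoring.next_edgeColor {v w : V} (h : T.Adj v w) :
    c.next v (c.edgeColor h) = w :=
  congrArg Subtype.val ((c.star v).symm_apply_apply ⟨w, h⟩)

theorem LegalColoring.next_eq_iff {v w : V} {a : Ω} (h : T.Adj v w) :
    c.next v a = w ↔ c.edgeColor h = a := by
  constructor
  · rintro rfl
    exact c.edgeColor_next v a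
  · rintro rfl
    exact c.next_edgeColor h

theorem LegalColoring.next_next (v : V) (a : Ω) : c.next (c.next v a) a = v := by
  have h := c.next_edgeColor (c.adj_next v a).symm
  rwa [c.edgeColor_symm (c.adj_next v a), c.edgeColor_next] at h

theorem LegalColoring.next_injective (v : V) : Function.Injective (c.next v) :=
  Subtype.val_injective.comp (c.star v).symm.injective

/-- `localPerm c g v a = a'` means that `g` sends the neighbour of `v` of color `a` to the
neighbour of `g v` of color `a'`. -/
theorem next_localPerm (g : T ≃g T) (v : V) (a : Ω) :
    c.next (g v) (localPerm c g v a) = g (c.next v a) := by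
  simp only [LegalColoring.next, localPerm, Equiv.trans_apply, Equiv.symm_apply_apply]
  rfl

theorem localPerm_next (g : T ≃g T) (v : V) (a : Ω) :
    localPerm c g (c.next v a) a = localPerm c g v a := by
  apply c.next_injective (g (c.next v a))
  have h := c.next_next (g v) (localPerm c g v a)
  rw [next_localPerm] at h
  rw [next_localPerm, c.next_next, h]

/-- A map of a tree to itself that is described around each vertex `v` by a permutation `t v` of
the colors is an automorphism, and the `t v` are its local permutations. -/
theorem exists_iso_of_local (hT : T.IsTree) (f : V → V) (t : V → Equiv.Perm Ω)
    (h : ∀ v a, f (c.next v a) = c.next (f v) (t v a)) :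
    ∃ g : T ≃g T, (∀ v, g v = f v) ∧ ∀ v, localPerm c g v = t v := by
  have hadj : ∀ {v w}, T.Adj v w → T.Adj (f v) (f w) := by
    intro v w hvw
    rw [← c.next_edgeColor hvw, h]
    exact c.adj_next _ _
  have hinj : Function.Injective f := by
    refine injective_of_locally_injective hT.isAcyclic hT.connected ⟨f, hadj⟩ ?_
    intro v w w' hw hw' heq
    change f w = f w' at heq
    rw [← c.next_edgeColor hw, ← c.next_edgeColor hw', h, h] at heq
    rw [← c.next_edgeColor hw, ← c.next_edgeColor hw',
      (t v).injective (c.next_injective _ heq)]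
  have hstep : ∀ v w', T.Adj (f v) w' → ∃ w, T.Adj v w ∧ f w = w' := by
    intro v w' hw
    refine ⟨c.next v ((t v).symm (c.edgeColor hw)), c.adj_next _ _, ?_⟩
    rw [h, Equiv.apply_symm_apply, c.next_edgeColor]
  have hsurj : Function.Surjective f := by
    have : ∀ {u u' : V} (p : T.Walk u u'), u ∈ Set.range f → u' ∈ Set.range f := by
      intro u u' p
      induction p with
      | nil => exact id
      | cons hd _ ih =>
        rintro ⟨v, rfl⟩
        obtain ⟨w, -, hw⟩ := hstep v _ hd
        exact ih ⟨w, hw⟩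
    intro u
    obtain ⟨v⟩ := hT.connected.nonempty
    obtain ⟨p⟩ := hT.connected.preconnected (f v) u
    exact this p ⟨v, rfl⟩
  let g : T ≃g T :=
    { toEquiv := Equiv.ofBijective f ⟨hinj, hsurj⟩
      map_rel_iff' := by
        intro v w
        refine ⟨fun hvw => ?_, hadj⟩
        obtain ⟨w', hw', he⟩ := hstep v (f w) hvw
        exact hinj he ▸ hw' }
  refine ⟨g, fun v => rfl, fun v => ?_⟩
  ext a
  apply c.next_injective (g v)
  rw [next_localPerm]
  exact h v a

/-- Automorphisms with prescribed local permutations modulo `F`. The local permutation at a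
vertex `v` is determined modulo `F` by `x v`, and its value on the color of the edge to the parent
of `v` is determined by the local permutation at the parent. As `F'` preserves the orbits of `F`,
the two conditions are compatible. -/
theorem exists_iso_localPerm (hT : T.IsTree) (v₀ : V) {F F' : Subgroup (Equiv.Perm Ω)}
    (hFF' : F ≤ F') (horb : PreservesOrbits F F') (x : V → F') :
    ∃ g : T ≃g T, g v₀ = v₀ ∧ ∀ v, localPerm c g v ∈ F' ∧ localPerm c g v * x v ∈ F := by
  have hstep : ∀ (v : V) (a : Ω) (s : F'), ∃ t : F', (t * x v : Equiv.Perm Ω) ∈ F ∧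
      (t : Equiv.Perm Ω) a = (s : Equiv.Perm Ω) a := by
    intro v a s
    have h1 := horb _ (F'.mul_mem s.2 (x v).2) ((x v : Equiv.Perm Ω)⁻¹ a)
    obtain ⟨u, hu⟩ := h1
    refine ⟨⟨u * (x v : Equiv.Perm Ω)⁻¹, F'.mul_mem (hFF' u.2) (F'.inv_mem (x v).2)⟩,
      by simp, ?_⟩
    simpa [Subgroup.smul_def] using hu
  choose t htF hta using hstep
  obtain ⟨par, hpar⟩ := exists_parent hT.connected v₀
  classical
  obtain ⟨f, hf0, hf⟩ := exists_rec_dist (T := T) (α := V × F') v₀ par (fun v hv => (hpar v hv).2)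
    (v₀, (x v₀)⁻¹) (fun v p =>
      if hv : v = v₀ then p else
        (c.next p.1 ((p.2 : Equiv.Perm Ω) (c.edgeColor (hpar v hv).1)),
          t v (c.edgeColor (hpar v hv).1) p.2))
  obtain ⟨g, hg, hgl⟩ := exists_iso_of_local c hT (fun v => (f v).1) (fun v => (f v).2) (by
    have key : ∀ v w, T.Adj v w → ∀ a, c.next v a = w →
        (f w).1 = c.next (f v).1 (((f v).2 : Equiv.Perm Ω) a) := by
      intro v w hvw
      refine adj_induction hT v₀ par hpar (P := fun v w => ∀ a, c.next v a = w →
        (f w).1 = c.next (f v).1 (((f v).2 : Equiv.Perm Ω) a)) (fun v hv => ⟨?_, ?_⟩) hvw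
      · intro a ha
        rw [c.next_eq_iff (hpar v hv).1] at ha
        subst ha
        rw [hf v hv, dif_neg hv]
        simp only
        rw [hta, c.next_next]
      · intro a ha
        have ha' := (c.next_eq_iff (hpar v hv).1.symm).1 ha
        rw [c.edgeColor_symm] at ha'
        rw [← ha', hf v hv, dif_neg hv]
    exact fun v a => key v _ (c.adj_next v a) a rfl)
  refine ⟨g, by rw [hg, hf0], fun v => ?_⟩
  rw [hgl]
  refine ⟨(f v).2.2, ?_⟩
  by_cases hv : v = v₀
  · subst hv
    simp [hf0, F.one_mem]
  · rw [hf v hv, dif_neg hv]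
    exact htF _ _ _

/-- For semi-regular `F`, an automorphism with local permutations in `F` that fixes a vertex and
its neighbours is trivial. -/
theorem eq_one_of_localPerm_mem (hT : T.IsTree) {v₀ : V} {F : Subgroup (Equiv.Perm Ω)}
    (hF : IsSemiregular F) {g : T ≃g T} (hg : ∀ v, localPerm c g v ∈ F) (h0 : g v₀ = v₀)
    (h1 : ∀ a, g (c.next v₀ a) = c.next v₀ a) : g = 1 := by
  have h2 : localPerm c g v₀ = 1 := by
    ext a
    apply c.next_injective (g v₀)
    rw [next_localPerm, h1, h0]
    rfl
  have key : ∀ {u v : V} (p : T.Walk u v), (g u = u ∧ localPerm c g u = 1) →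
      g v = v ∧ localPerm c g v = 1 := by
    intro u v p
    induction p with
    | nil => exact id
    | @cons u w v h _ ih =>
      rintro ⟨hu, hlu⟩
      obtain ⟨a, rfl⟩ : ∃ a, c.next u a = w := ⟨_, c.next_edgeColor h⟩
      refine ih ⟨?_, ?_⟩
      · rw [← next_localPerm, hu, hlu]
        rfl
      · refine hF _ (hg _) a ?_
        rw [localPerm_next, hlu]
        rfl
  ext v
  obtain ⟨p⟩ := hT.connected.preconnected v₀ v
  exact (key p ⟨h0, h2⟩).1

end Tree

/-! ### A criterion for cocompact lattices -/

section Lattice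

open MeasureTheory MeasureTheory.Measure Pointwise

/-- Double counting: if each point of `A` lies in exactly `k` of the sets `B i`, then the measures
of the `A ∩ B i` add up to `k` times the measure of `A`. -/
theorem sum_measure_inter_eq {α ι : Type*} [MeasurableSpace α] (μ : Measure α) (S : Finset ι)
    {A : Set α} (hA : MeasurableSet A) (B : ι → Set α) (hB : ∀ i, MeasurableSet (B i)) (k : ℕ)
    (hk : ∀ x ∈ A, {i | i ∈ S ∧ x ∈ B i}.ncard = k) :
    ∑ i ∈ S, μ (A ∩ B i) = k * μ A := by
  classical
  calc ∑ i ∈ S, μ (A ∩ B i)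
      = ∑ i ∈ S, ∫⁻ x in A, (B i).indicator 1 x ∂μ := by
        refine Finset.sum_congr rfl fun i _ => ?_
        rw [lintegral_indicator_one (hB i), Measure.restrict_apply (hB i), Set.inter_comm]
    _ = ∫⁻ x in A, ∑ i ∈ S, (B i).indicator 1 x ∂μ :=
        (lintegral_finsetSum _ fun i _ => measurable_one.indicator (hB i)).symm
    _ = ∫⁻ _ in A, (k : ENNReal) ∂μ := by
        refine setLIntegral_congr_fun hA fun x hx => ?_
        rw [← hk x hx]
        have : {i | i ∈ S ∧ x ∈ B i} = ((S.filter fun i => x ∈ B i : Finset ι) : Set ι) := by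
          ext; simp
        rw [this, Set.ncard_coe_finset, Finset.card_filter]
        simp [Set.indicator_apply]
    _ = k * μ A := by simp

variable {G : Type*} [Group G]

/-- The number of `γ ∈ Γ` with `g γ ∈ O` does not depend on `g`, if `G = O Γ`. -/
theorem ncard_mul_mem_eq (O Γ : Subgroup G)
    (hOΓ : ∀ g : G, ∃ γ ∈ Γ, g * γ ∈ O) (g : G) :
    {γ | γ ∈ Γ ∧ g * γ ∈ O}.ncard = {γ | γ ∈ Γ ∧ γ ∈ O}.ncard := by
  obtain ⟨γ₀, hγ₀, h⟩ := hOΓ g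
  have : {γ | γ ∈ Γ ∧ g * γ ∈ O} = (γ₀ * ·) '' {γ | γ ∈ Γ ∧ γ ∈ O} := by
    ext γ
    simp only [Set.mem_ofPred_eq, Set.mem_image]
    constructor
    · rintro ⟨h1, h2⟩
      refine ⟨γ₀⁻¹ * γ, ⟨Γ.mul_mem (Γ.inv_mem hγ₀) h1, ?_⟩, by group⟩
      have := O.mul_mem (O.inv_mem h) h2
      convert this using 1
      group
    · rintro ⟨δ, ⟨h1, h2⟩, rfl⟩
      refine ⟨Γ.mul_mem hγ₀ h1, ?_⟩
      rw [← mul_assoc]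
      exact O.mul_mem h h2
  rw [this, Set.ncard_image_of_injective _ (mul_right_injective γ₀)]

variable [TopologicalSpace G] [IsTopologicalGroup G]

/-- A Haar measure is invariant under right translation by the elements of a compact open
subgroup: such a translation preserves the subgroup, whose measure is neither `0` nor infinite. -/
theorem map_mul_right_eq_self [LocallyCompactSpace G] [MeasurableSpace G] [BorelSpace G]
    (μ : Measure G) [μ.IsHaarMeasure] [μ.Regular] (P : Subgroup G) (hPo : IsOpen (P : Set G))
    (hPc : IsCompact (P : Set G)) {g : G} (hg : g ∈ P) : μ.map (· * g) = μ := by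
  have : (μ.map (· * g)).Regular := Regular.map (Homeomorph.mulRight g)
  have h := isMulLeftInvariant_eq_smul_of_regular (μ.map (· * g)) μ
  have h1 : μ.map (· * g) P = μ P := by
    rw [Measure.map_apply (measurable_mul_const g) hPo.measurableSet]
    congr 1
    ext x
    exact P.mul_mem_cancel_right hg
  have h2 : (haarScalarFactor (μ.map (· * g)) μ : ENNReal) * μ P = 1 * μ P := by
    conv_rhs => rw [one_mul, ← h1, h]
    rfl
  have h3 := (ENNReal.mul_left_inj (hPo.measure_ne_zero μ ⟨1, P.one_mem⟩)
    hPc.measure_lt_top.ne).1 h2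
  rw [h, ENNReal.coe_eq_one.1 h3, one_smul]

/-- The finite invariant measure on `G ⧸ Γ` is the image of the restriction to `O` of a Haar
measure `μ` of `G`. Its invariance means `μ (h O ∩ X) = μ (O ∩ X)` for all `h` and all right
`Γ`-invariant sets `X`. It is obtained by counting, for `γ ∈ Γ`, the `g ∈ h O ∩ X` with
`g γ ∈ O`: a right translation by `γ` carries these to the `g ∈ O ∩ X` with `g γ⁻¹ ∈ h O`. -/
theorem isCocompactLattice_of_mul_eq_univ [T2Space G] (O Γ : Subgroup G) (hOo : IsOpen (O : Set G))
    (hOc : IsCompact (O : Set G)) (hΓ : DiscreteTopology Γ)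
    (hOΓ : ∀ g : G, ∃ γ ∈ Γ, g * γ ∈ O)
    (hP : ∀ g : G, ∃ P : Subgroup G, IsOpen (P : Set G) ∧ IsCompact (P : Set G) ∧ g ∈ P) :
    IsCocompactLattice Γ := by
  have hlc : LocallyCompactSpace G :=
    hOc.locallyCompactSpace_of_mem_nhds_of_group (hOo.mem_nhds O.one_mem)
  refine ⟨hΓ, ?_, ?_⟩
  · borelize G
    let _ : MeasurableSpace (G ⧸ Γ) := borel (G ⧸ Γ)
    have : BorelSpace (G ⧸ Γ) := ⟨rfl⟩
    let μ : Measure G := haar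
    let π : G → G ⧸ Γ := QuotientGroup.mk
    have hπ : Measurable π := (show Continuous π from continuous_quot_mk).measurable
    have hfin : ∀ C : Set G, IsCompact C → {γ | γ ∈ Γ ∧ γ ∈ C}.Finite := by
      intro C hC
      have h1 : IsCompact ((Γ : Set G) ∩ C) := hC.inter_left Γ.isClosed_of_discrete
      refine h1.finite ?_
      exact (isDiscrete_iff_discreteTopology.2 hΓ).mono Set.inter_subset_left
    set k := {γ | γ ∈ Γ ∧ γ ∈ O}.ncard with hkdef
    have hk0 : (k : ENNReal) ≠ 0 := by
      rw [Nat.cast_ne_zero]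
      exact Set.ncard_ne_zero_of_mem ⟨Γ.one_mem, O.one_mem⟩ (hfin _ hOc)
    have hinv : ∀ (h : G) (X : Set G), MeasurableSet X → (∀ x, ∀ γ ∈ Γ, x * γ ∈ X ↔ x ∈ X) →
        μ ({g | h⁻¹ * g ∈ O} ∩ X) = μ (O ∩ X) := by
      intro h X hX hXΓ
      have hhO : MeasurableSet {g | h⁻¹ * g ∈ O} :=
        hOo.measurableSet.preimage (measurable_const_mul h⁻¹)
      -- all `γ` that move some point of `h O` into `O`
      have hS := hfin ((O : Set G) * ({h⁻¹} * (O : Set G)))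
        (hOc.mul (isCompact_singleton.mul hOc))
      have hmemS : ∀ g γ, γ ∈ Γ → h⁻¹ * g ∈ O → g * γ ∈ O → γ ∈ hS.toFinset := by
        intro g γ hγ h1 h2
        rw [Set.Finite.mem_toFinset]
        exact ⟨hγ, Set.mem_mul.2 ⟨(h⁻¹ * g)⁻¹, O.inv_mem h1, h⁻¹ * (g * γ),
          Set.mem_mul.2 ⟨h⁻¹, rfl, g * γ, h2, rfl⟩, by group⟩⟩
      have e1 : ∑ γ ∈ hS.toFinset, μ (({g | h⁻¹ * g ∈ O} ∩ X) ∩ {g | g * γ ∈ O})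
          = k * μ ({g | h⁻¹ * g ∈ O} ∩ X) := by
        refine sum_measure_inter_eq μ _ (hhO.inter hX) (fun γ => {g | g * γ ∈ O})
          (fun γ => hOo.measurableSet.preimage (measurable_mul_const γ)) k ?_
        rintro g ⟨hg, -⟩
        rw [hkdef, ← ncard_mul_mem_eq O Γ hOΓ g]
        refine congrArg Set.ncard (Set.ext fun γ => ?_)
        exact ⟨fun hx => ⟨((Set.Finite.mem_toFinset _).1 hx.1).1, hx.2⟩,
          fun hx => ⟨hmemS g γ hx.1 hg hx.2, hx.2⟩⟩
      have e2 : ∑ γ ∈ hS.toFinset, μ ((O ∩ X) ∩ {g | h⁻¹ * (g * γ⁻¹) ∈ O})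
          = k * μ (O ∩ X) := by
        refine sum_measure_inter_eq μ _ (hOo.measurableSet.inter hX)
          (fun γ => {g | h⁻¹ * (g * γ⁻¹) ∈ O})
          (fun γ => hhO.preimage (measurable_mul_const γ⁻¹)) k ?_
        rintro g ⟨hg, -⟩
        have himg : {γ | γ ∈ hS.toFinset ∧ h⁻¹ * (g * γ⁻¹) ∈ O}
            = {γ | γ ∈ Γ ∧ h⁻¹ * g * γ ∈ O}⁻¹ := by
          ext γ
          change _ ∧ _ ↔ γ⁻¹ ∈ Γ ∧ h⁻¹ * g * γ⁻¹ ∈ O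
          rw [mul_assoc, Γ.inv_mem_iff]
          exact ⟨fun hx => ⟨((Set.Finite.mem_toFinset _).1 hx.1).1, hx.2⟩, fun hx =>
            ⟨hmemS (g * γ⁻¹) γ hx.1 hx.2 (by rwa [inv_mul_cancel_right]), hx.2⟩⟩
        rw [hkdef, ← ncard_mul_mem_eq O Γ hOΓ (h⁻¹ * g)]
        refine (congrArg Set.ncard himg).trans ?_
        rw [← Set.image_inv_eq_inv, Set.ncard_image_of_injective _ inv_injective]
      have e3 : ∀ γ ∈ hS.toFinset, μ (({g | h⁻¹ * g ∈ O} ∩ X) ∩ {g | g * γ ∈ O})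
          = μ ((O ∩ X) ∩ {g | h⁻¹ * (g * γ⁻¹) ∈ O}) := by
        intro γ hγ
        obtain ⟨P, hPo, hPc, hγP⟩ := hP γ
        conv_rhs => rw [← map_mul_right_eq_self μ P hPo hPc hγP]
        rw [Measure.map_apply (measurable_mul_const γ)]
        · congr 1
          ext g
          simp only [Set.mem_inter_iff, Set.mem_ofPred_eq, Set.mem_preimage, SetLike.mem_coe,
            mul_inv_cancel_right, hXΓ g γ ((Set.Finite.mem_toFinset _).1 hγ).1]
          tauto
        · exact (hOo.measurableSet.inter hX).inter (hhO.preimage (measurable_mul_const γ⁻¹))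
      rw [Finset.sum_congr rfl e3, e2] at e1
      exact ((ENNReal.mul_right_inj hk0 (ENNReal.natCast_ne_top k)).1 e1).symm
    refine ⟨(μ.restrict O).map π, ?_, ?_, ?_⟩
    · have : IsFiniteMeasure (μ.restrict O) := ⟨by
        rw [Measure.restrict_apply_univ]; exact hOc.measure_lt_top⟩
      infer_instance
    · intro h0
      have h1 : (μ.restrict O).map π Set.univ = 0 := by rw [h0]; rfl
      rw [Measure.map_apply hπ MeasurableSet.univ, Set.preimage_univ,
        Measure.restrict_apply_univ] at h1
      exact hOo.measure_ne_zero μ ⟨1, O.one_mem⟩ h1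
    · intro g s hs
      have hsm : Measurable fun x : G ⧸ Γ => g • x := (continuous_const_smul g).measurable
      rw [Measure.map_apply hπ (hsm hs), Measure.map_apply hπ hs,
        Measure.restrict_apply (hπ (hsm hs)), Measure.restrict_apply (hπ hs),
        Set.inter_comm, Set.inter_comm _ (O : Set G),
        ← hinv g (π ⁻¹' s) (hπ hs)]
      · refine Eq.trans ?_ (measure_preimage_mul μ g _)
        congr 1
        ext x
        simp [π]
      · intro x γ hγ
        simp [π, Set.mem_preimage, QuotientGroup.mk_mul_of_mem x hγ]
  · have h1 : (QuotientGroup.mk '' (O : Set G) : Set (G ⧸ Γ)) = Set.univ := by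
      refine Set.eq_univ_of_forall fun x => ?_
      obtain ⟨g, rfl⟩ := QuotientGroup.mk_surjective x
      obtain ⟨γ, hγ, h⟩ := hOΓ g
      exact ⟨g * γ, h, QuotientGroup.mk_mul_of_mem g hγ⟩
    exact ⟨h1 ▸ hOc.image continuous_quot_mk⟩

end Lattice

/-! ### The topology of the wreath product -/

section Topology

open Topology Pointwise

variable {V : Type*} {T : SimpleGraph V} {B : Type*} [Group B] {A : Subgroup B}

/-- The basic neighbourhood `(σ U_I, γ W_I)` of `(σ, γ)`, where `U_I` consists of the functions
with values in `A` that are trivial on `I`, and `W_I` is the pointwise stabilizer of `I`. -/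
def basicNhd (g : SemiRestrictedWreath V A (T ≃g T)) (I : Set V) :
    Set (SemiRestrictedWreath V A (T ≃g T)) :=
  {h | (∀ v, (g.left.1 v)⁻¹ * h.left.1 v ∈ A) ∧ (∀ v ∈ I, h.left.1 v = g.left.1 v) ∧
    ∀ v ∈ I, h.right v = g.right v}

theorem nhds_semiRestricted_hasBasis (σ : semiRestricted V A) :
    (𝓝 σ).HasBasis (fun I : Set V => I.Finite) fun I =>
      {τ | (∀ v, (σ.1 v)⁻¹ * τ.1 v ∈ A) ∧ ∀ v ∈ I, τ.1 v = σ.1 v} := by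
  refine ⟨fun s => ?_⟩
  rw [mem_nhds_iff]
  constructor
  · rintro ⟨t, hts, ht, hσ⟩
    obtain ⟨I, hI⟩ := ht σ hσ
    refine ⟨I, I.finite_toSet, fun τ hτ => hts (hI τ hτ.1 fun v hv => ?_)⟩
    rw [hτ.2 v hv, inv_mul_cancel]
  · rintro ⟨I, hI, hs⟩
    refine ⟨_, hs, fun τ hτ => ⟨hI.toFinset, fun ρ h1 h2 => ⟨fun v => ?_, fun v hv => ?_⟩⟩,
      fun v => by rw [inv_mul_cancel]; exact A.one_mem, fun v _ => rfl⟩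
    · have := A.mul_mem (hτ.1 v) (h1 v)
      rwa [mul_assoc, mul_inv_cancel_left] at this
    · rw [← hτ.2 v hv, eq_comm, ← inv_mul_eq_one]
      exact h2 v (hI.mem_toFinset.2 hv)

theorem nhds_aut_hasBasis (g : T ≃g T) :
    (𝓝 g).HasBasis (fun I : Set V => I.Finite) fun I => {h | ∀ v ∈ I, h v = g v} := by
  let _ : TopologicalSpace V := ⊥
  have : DiscreteTopology V := ⟨rfl⟩
  have h1 : 𝓝 g = Filter.comap (fun (g : T ≃g T) (v : V) => g v) (𝓝 fun v => g v) :=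
    nhds_induced _ _
  have h2 := Filter.hasBasis_pi fun v : V => Filter.hasBasis_pure (g v)
  rw [h1, nhds_pi]
  simp only [nhds_discrete]
  refine ⟨fun s => ?_⟩
  rw [(h2.comap _).mem_iff]
  constructor
  · rintro ⟨⟨I, _⟩, ⟨hI, -⟩, hs⟩
    refine ⟨I, hI, fun h hh => hs ?_⟩
    intro v hv
    exact hh v hv
  · rintro ⟨I, hI, hs⟩
    refine ⟨⟨I, fun _ => ()⟩, ⟨hI, fun _ _ => trivial⟩, fun h hh => hs fun v hv => ?_⟩
    exact hh v hv

theorem nhds_wreath_hasBasis (g : SemiRestrictedWreath V A (T ≃g T)) :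
    (𝓝 g).HasBasis (fun I : Set V => I.Finite) (basicNhd g) := by
  have h1 : 𝓝 g = Filter.comap (fun g : SemiRestrictedWreath V A (T ≃g T) => (g.left, g.right))
      (𝓝 (g.left, g.right)) := nhds_induced _ _
  rw [h1, nhds_prod_eq]
  refine ⟨fun s => ?_⟩
  rw [(((nhds_semiRestricted_hasBasis g.left).prod (nhds_aut_hasBasis g.right)).comap _).mem_iff]
  constructor
  · rintro ⟨⟨I, J⟩, ⟨hI, hJ⟩, hs⟩
    refine ⟨I ∪ J, hI.union hJ, fun h hh => hs ?_⟩
    exact ⟨⟨hh.1, fun v hv => hh.2.1 v (Or.inl hv)⟩, fun v hv => hh.2.2 v (Or.inr hv)⟩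
  · rintro ⟨I, hI, hs⟩
    exact ⟨⟨I, I⟩, ⟨hI, hI⟩, fun h hh => hs ⟨hh.1.1, hh.1.2, hh.2⟩⟩

theorem wreath_mul_left (g h : SemiRestrictedWreath V A (T ≃g T)) (v : V) :
    (g * h).left.1 v = g.left.1 v * h.left.1 (g.right⁻¹ v) := rfl

theorem wreath_inv_left (g : SemiRestrictedWreath V A (T ≃g T)) (v : V) :
    (g⁻¹).left.1 v = (g.left.1 (g.right v))⁻¹ := by
  change (g.left.1 (g.right⁻¹⁻¹ v))⁻¹ = _
  rw [inv_inv]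

theorem iso_inv_apply_eq {g : T ≃g T} {v w : V} : g⁻¹ v = w ↔ v = g w :=
  g.toEquiv.symm_apply_eq

theorem iso_apply_inv (g : T ≃g T) (v : V) : g (g⁻¹ v) = v := g.apply_symm_apply v

theorem iso_inv_apply (g : T ≃g T) (v : V) : g⁻¹ (g v) = v := g.symm_apply_apply v

/-- Let `g'` and `h'` be close to `g` and `h`. At the vertices in `I`, and at those where the
shifted `h.left` is not in `A`, the left components of `g' * h'` and `g * h` coincide. At all the
other vertices they differ by an element of `A`, as the `h`-factors are in `A`. -/
instance wreath_continuousMul : ContinuousMul (SemiRestrictedWreath V A (T ≃g T)) := by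
  refine ⟨continuous_iff_continuousAt.2 ?_⟩
  rintro ⟨g, h⟩
  rw [ContinuousAt, nhds_prod_eq, ((nhds_wreath_hasBasis g).prod
    (nhds_wreath_hasBasis h)).tendsto_iff (nhds_wreath_hasBasis _)]
  intro I hI
  -- outside `S` the function `h.left` takes its values in `A`
  let S : Set V := {v | h.left.1 v ∉ A}
  have hS : S.Finite := h.left.2
  let J : Set V := (I ∪ S) ∪ (g.right '' S ∪ ⇑(g.right⁻¹) '' I ∪ h.right '' I)
  have hJ : J.Finite := (hI.union hS).union
    (((hS.image _).union (hI.image _)).union (hI.image _))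
  refine ⟨⟨J, J⟩, ⟨hJ, hJ⟩, ?_⟩
  rintro ⟨g', h'⟩ ⟨⟨hg1, hg2, hg3⟩, ⟨hh1, hh2, hh3⟩⟩
  have key : ∀ v, v ∈ I ∨ g.right⁻¹ v ∈ S → (g' * h').left.1 v = (g * h).left.1 v := by
    intro v hv
    have hvJ : v ∈ J := by
      rcases hv with hv | hv
      · exact Or.inl (Or.inl hv)
      · exact Or.inr (Or.inl (Or.inl ⟨_, hv, iso_apply_inv _ _⟩))
    have hwJ : g.right⁻¹ v ∈ J := by
      rcases hv with hv | hv
      · exact Or.inr (Or.inl (Or.inr ⟨v, hv, rfl⟩))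
      · exact Or.inl (Or.inr hv)
    have hw : g'.right⁻¹ v = g.right⁻¹ v := by
      rw [iso_inv_apply_eq, hg3 _ hwJ, iso_apply_inv]
    rw [wreath_mul_left, wreath_mul_left, hw, hg2 v hvJ, hh2 _ hwJ]
  refine ⟨fun v => ?_, fun v hv => key v (Or.inl hv), fun v hv => ?_⟩
  · by_cases hv : g.right⁻¹ v ∈ S
    · change _⁻¹ * (g' * h').left.1 v ∈ A
      rw [key v (Or.inr hv), inv_mul_cancel]
      exact A.one_mem
    · -- `g'.right` and `g.right` agree on `S`, so they have the same image of `S`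
      have hv' : g'.right⁻¹ v ∉ S := by
        intro hs
        apply hv
        have h1 := hg3 _ (Or.inl (Or.inr hs))
        rw [iso_apply_inv] at h1
        rwa [h1, iso_inv_apply]
      have h2 : h'.left.1 (g'.right⁻¹ v) ∈ A := by
        have := A.mul_mem (not_not.1 hv') (hh1 (g'.right⁻¹ v))
        rwa [mul_inv_cancel_left] at this
      have h3 := A.mul_mem (A.mul_mem (A.inv_mem (not_not.1 hv)) (hg1 v)) h2
      change ((g * h).left.1 v)⁻¹ * (g' * h').left.1 v ∈ A
      rw [wreath_mul_left, wreath_mul_left]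
      convert h3 using 1
      group
  · change g'.right (h'.right v) = g.right (h.right v)
    rw [hh3 v (Or.inl (Or.inl hv)), hg3 _ (Or.inr (Or.inr ⟨v, hv, rfl⟩))]

instance wreath_continuousInv : ContinuousInv (SemiRestrictedWreath V A (T ≃g T)) := by
  refine ⟨continuous_iff_continuousAt.2 fun g => ?_⟩
  rw [ContinuousAt, (nhds_wreath_hasBasis g).tendsto_iff (nhds_wreath_hasBasis _)]
  intro I hI
  -- outside `S` the function `g.left` takes its values in `A`
  let S : Set V := {v | g.left.1 v ∉ A}
  have hS : S.Finite := g.left.2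
  let J : Set V := ((I ∪ S) ∪ g.right '' I) ∪ ⇑(g.right⁻¹) '' (S ∪ I)
  have hJ : J.Finite := ((hI.union hS).union (hI.image _)).union ((hS.union hI).image _)
  refine ⟨J, hJ, ?_⟩
  rintro g' ⟨hg1, hg2, hg3⟩
  have key : ∀ v, v ∈ I ∨ g.right v ∈ S → (g'⁻¹).left.1 v = (g⁻¹).left.1 v := by
    intro v hv
    have hvJ : v ∈ J := by
      rcases hv with hv | hv
      · exact Or.inl (Or.inl (Or.inl hv))
      · exact Or.inr ⟨_, Or.inl hv, iso_inv_apply _ _⟩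
    have hwJ : g.right v ∈ J := by
      rcases hv with hv | hv
      · exact Or.inl (Or.inr ⟨v, hv, rfl⟩)
      · exact Or.inl (Or.inl (Or.inr hv))
    rw [wreath_inv_left, wreath_inv_left, hg3 v hvJ, hg2 _ hwJ]
  refine ⟨fun v => ?_, fun v hv => key v (Or.inl hv), fun v hv => ?_⟩
  · by_cases hv : g.right v ∈ S
    · rw [key v (Or.inr hv), inv_mul_cancel]
      exact A.one_mem
    · have hv' : g'.right v ∉ S := by
        intro hs
        apply hv
        have h1 := hg3 (g.right⁻¹ (g'.right v)) (Or.inr ⟨_, Or.inl hs, rfl⟩)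
        rw [iso_apply_inv] at h1
        rwa [← iso_inv_apply_eq.1 (g'.right.injective h1)]
      have h2 : g'.left.1 (g'.right v) ∈ A := by
        have := A.mul_mem (not_not.1 hv') (hg1 (g'.right v))
        rwa [mul_inv_cancel_left] at this
      rw [wreath_inv_left, wreath_inv_left, inv_inv]
      exact A.mul_mem (not_not.1 hv) (A.inv_mem h2)
  · change g'.right⁻¹ v = g.right⁻¹ v
    rw [iso_inv_apply_eq, hg3 _ (Or.inr ⟨v, Or.inr hv, rfl⟩), iso_apply_inv]

instance wreath_isTopologicalGroup : IsTopologicalGroup (SemiRestrictedWreath V A (T ≃g T)) where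

instance wreath_t2Space : T2Space (SemiRestrictedWreath V A (T ≃g T)) := by
  have : T1Space (SemiRestrictedWreath V A (T ≃g T)) := by
    refine t1Space_iff_exists_open.2 fun g h hne => ?_
    by_contra hcon
    push Not at hcon
    have hmem : ∀ v : V, h ∈ basicNhd g {v} := by
      intro v
      have h1 := (nhds_wreath_hasBasis g).mem_of_mem (Set.finite_singleton v)
      obtain ⟨U, hU, hUo, hgU⟩ := mem_nhds_iff.1 h1
      exact hU (hcon U hUo hgU)
    apply hne
    refine SemidirectProduct.ext (Subtype.ext (funext fun v => ?_)) (RelIso.ext fun v => ?_)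
    · exact ((hmem v).2.1 v rfl).symm
    · exact ((hmem v).2.2 v rfl).symm
  infer_instance

/-- The subgroup of the wreath product made of the `(σ, γ)` for which `γ` fixes `v₀` and `σ` takes
its values in `A` outside the finite set `S`, which has to be invariant under the stabilizer of
`v₀`. -/
def levelSubgroup (T : SimpleGraph V) (A : Subgroup B) (v₀ : V) (S : Set V)
    (hS : ∀ g : T ≃g T, g v₀ = v₀ → ∀ v, g v ∈ S ↔ v ∈ S) :
    Subgroup (SemiRestrictedWreath V A (T ≃g T)) where
  carrier := {g | g.right v₀ = v₀ ∧ ∀ v ∉ S, g.left.1 v ∈ A}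
  one_mem' := ⟨rfl, fun _ _ => A.one_mem⟩
  mul_mem' := by
    rintro g h ⟨hg, hg'⟩ ⟨hh, hh'⟩
    refine ⟨?_, fun v hv => ?_⟩
    · change g.right (h.right v₀) = v₀
      rw [hh, hg]
    · rw [wreath_mul_left]
      refine A.mul_mem (hg' v hv) (hh' _ ?_)
      rwa [← hS _ hg, iso_apply_inv]
  inv_mem' := by
    rintro g ⟨hg, hg'⟩
    refine ⟨?_, fun v hv => ?_⟩
    · change g.right⁻¹ v₀ = v₀
      rw [iso_inv_apply_eq, hg]
    · rw [wreath_inv_left]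
      refine A.inv_mem (hg' _ ?_)
      rwa [hS _ hg]

theorem isOpen_levelSubgroup {v₀ : V} {S : Set V}
    (hS : ∀ g : T ≃g T, g v₀ = v₀ → ∀ v, g v ∈ S ↔ v ∈ S) :
    IsOpen (levelSubgroup T A v₀ S hS : Set (SemiRestrictedWreath V A (T ≃g T))) := by
  refine Subgroup.isOpen_of_mem_nhds _ (g := 1) ?_
  refine (nhds_wreath_hasBasis 1).mem_iff.2 ⟨{v₀}, Set.finite_singleton v₀, ?_⟩
  rintro g ⟨h1, -, h3⟩
  refine ⟨h3 v₀ rfl, fun v _ => ?_⟩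
  have := h1 v
  change (1 : B)⁻¹ * _ ∈ A at this
  rwa [inv_one, one_mul] at this

/-- The orbits of a vertex stabilizer in a connected locally finite graph are finite. -/
theorem finite_orbit_stabilizer [T.LocallyFinite] (hT : T.Connected) (v₀ v : V) :
    {w | ∃ g : T ≃g T, g v₀ = v₀ ∧ g v = w}.Finite := by
  obtain ⟨p⟩ := hT.preconnected v₀ v
  have key : ∀ {u v : V} (p : T.Walk u v), {w | ∃ g : T ≃g T, g v₀ = v₀ ∧ g u = w}.Finite →
      {w | ∃ g : T ≃g T, g v₀ = v₀ ∧ g v = w}.Finite := by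
    intro u v p
    induction p with
    | nil => exact id
    | cons h _ ih =>
      intro hu
      refine ih ((hu.biUnion fun x _ => (T.neighborSet x).toFinite).subset ?_)
      rintro _ ⟨g, hg, rfl⟩
      exact Set.mem_biUnion ⟨g, hg, rfl⟩ (g.map_adj_iff.2 h)
  refine key p ((Set.finite_singleton v₀).subset ?_)
  rintro _ ⟨g, hg, rfl⟩
  exact hg

theorem isCompact_stabilizer [T.LocallyFinite] (hT : T.Connected) (v₀ : V) :
    IsCompact {g : T ≃g T | g v₀ = v₀} := by
  let _ : TopologicalSpace V := ⊥
  have : DiscreteTopology V := ⟨rfl⟩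
  -- an automorphism is encoded by its graph together with the graph of its inverse
  let Z : Set ((V → V) × (V → V)) := {p | ∀ v w, (p.1 v = w ↔ p.2 w = v) ∧
    (T.Adj (p.1 v) (p.1 w) ↔ T.Adj v w)}
  let C : Set (V → V) := Set.univ.pi fun v => {w | ∃ g : T ≃g T, g v₀ = v₀ ∧ g v = w}
  have hC : IsCompact C :=
    isCompact_univ_pi fun v => (finite_orbit_stabilizer hT v₀ v).isCompact
  have hZ : IsClosed Z := by
    have h1 : ∀ v, Continuous fun p : (V → V) × (V → V) => p.1 v :=
      fun v => (continuous_apply v).comp continuous_fst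
    have h2 : ∀ v, Continuous fun p : (V → V) × (V → V) => p.2 v :=
      fun v => (continuous_apply v).comp continuous_snd
    -- each condition involves finitely many coordinates, so it defines a clopen set
    have h3 : Z = ⋂ v, ⋂ w,
        (fun p : (V → V) × (V → V) => ((p.1 v, p.1 w), p.2 w)) ⁻¹'
          {x | (x.1.1 = w ↔ x.2 = v) ∧ (T.Adj x.1.1 x.1.2 ↔ T.Adj v w)} := by
      ext p
      simp only [Set.mem_iInter]
      rfl
    rw [h3]
    exact isClosed_iInter fun v => isClosed_iInter fun w =>
      (isClosed_discrete _).preimage (((h1 v).prodMk (h1 w)).prodMk (h2 w))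
  let F : Z → (T ≃g T) := fun p =>
    { toFun := p.1.1
      invFun := p.1.2
      left_inv := fun v => ((p.2 v _).1.1 rfl)
      right_inv := fun v => ((p.2 _ v).1.2 rfl)
      map_rel_iff' := (p.2 _ _).2 }
  have hF : Continuous F := continuous_induced_rng.2
    (continuous_fst.comp continuous_subtype_val)
  have hK : IsCompact {p : Z | p.1 ∈ C ×ˢ C} :=
    hZ.isClosedEmbedding_subtypeVal.isCompact_preimage (hC.prod hC)
  convert hK.image hF using 1
  ext g
  constructor
  · intro hg
    refine ⟨⟨(g, ⇑g⁻¹), fun _ _ =>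
        ⟨by rw [eq_comm, ← iso_inv_apply_eq], g.map_adj_iff⟩⟩,
      ⟨fun v _ => ⟨g, hg, rfl⟩, fun v _ => ⟨g⁻¹, iso_inv_apply_eq.2 hg.symm, rfl⟩⟩, ?_⟩
    ext v
    rfl
  · rintro ⟨p, hp, rfl⟩
    obtain ⟨g, hg, hg'⟩ := hp.1 v₀ trivial
    exact hg'.symm.trans hg

theorem isCompact_levelSubgroup [Finite B] [T.LocallyFinite] (hT : T.Connected) {v₀ : V}
    {S : Set V} (hSf : S.Finite) (hS : ∀ g : T ≃g T, g v₀ = v₀ → ∀ v, g v ∈ S ↔ v ∈ S) :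
    IsCompact (levelSubgroup T A v₀ S hS : Set (SemiRestrictedWreath V A (T ≃g T))) := by
  let _ : TopologicalSpace B := ⊥
  have : DiscreteTopology B := ⟨rfl⟩
  let C : Set (V → B) := Set.univ.pi fun v => {b | v ∉ S → b ∈ A}
  have hC : IsCompact C := isCompact_univ_pi fun v => (Set.toFinite _).isCompact
  let E : C → semiRestricted V A := fun f =>
    ⟨f.1, hSf.subset fun v hv => by_contra fun hvS => hv (f.2 v trivial hvS)⟩
  have hE : Continuous E := by
    refine continuous_iff_continuousAt.2 fun f => ?_
    rw [ContinuousAt, (nhds_semiRestricted_hasBasis _).tendsto_right_iff]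
    intro I hI
    have h1 : {f' : C | ∀ v ∈ I ∪ S, f'.1 v = f.1 v} ∈ 𝓝 f := by
      refine (Filter.eventually_all_finite (hI.union hSf)).2 fun v _ => ?_
      have h2 : Continuous fun f' : C => f'.1 v :=
        (continuous_apply v).comp continuous_subtype_val
      exact h2.continuousAt.eventually ((isOpen_discrete {f.1 v}).mem_nhds rfl)
    filter_upwards [h1] with f' hf'
    refine ⟨fun v => ?_, fun v hv => hf' v (Or.inl hv)⟩
    by_cases hv : v ∈ S
    · change (f.1 v)⁻¹ * f'.1 v ∈ A
      rw [hf' v (Or.inr hv), inv_mul_cancel]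
      exact A.one_mem
    · exact A.mul_mem (A.inv_mem (f.2 v trivial hv)) (f'.2 v trivial hv)
  have hK := isCompact_stabilizer (T := T) hT v₀
  have : CompactSpace C := isCompact_iff_compactSpace.1 hC
  let M : C × (T ≃g T) → SemiRestrictedWreath V A (T ≃g T) := fun p => ⟨E p.1, p.2⟩
  have hM : Continuous M := continuous_induced_rng.2
    ((hE.comp continuous_fst).prodMk continuous_snd)
  convert (isCompact_univ.prod hK).image hM using 1
  ext g
  constructor
  · rintro ⟨h1, h2⟩
    exact ⟨⟨⟨g.left.1, fun v _ => h2 v⟩, g.right⟩, ⟨trivial, h1⟩, rfl⟩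
  · rintro ⟨⟨f, k⟩, ⟨-, hk⟩, rfl⟩
    exact ⟨hk, fun v hv => f.2 v trivial hv⟩

end Topology

/-! ### The lattice -/

section Main

variable {V Ω : Type*} {T : SimpleGraph V}

theorem exists_equiv_quotient {G : Type*} [Group G] {H : Subgroup G} {n : ℕ} [NeZero n]
    (hn : H.index = n) : ∃ b : Fin n ≃ G ⧸ H, b 0 = ((1 : G) : G ⧸ H) := by
  classical
  have hcard : Nat.card (G ⧸ H) = n := hn
  have : Finite (G ⧸ H) := Nat.finite_of_card_ne_zero (hcard ▸ NeZero.ne n)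
  let b := (Finite.equivFinOfCardEq hcard).symm
  exact ⟨b.trans (Equiv.swap (b 0) ((1 : G) : G ⧸ H)), by simp⟩

/-- Each `h ∈ H_{n,d}` fixes the finite union of the orbits, under the stabilizer of `v₀`, of the
vertices at which the `𝔖_n`-component of `h` is not in `𝔖_{n-1}`. So `h` lies in a compact open
subgroup. -/
theorem exists_levelSubgroup_mem [T.LocallyFinite] (hT : T.Connected) {n : ℕ} [NeZero n] {v₀ : V}
    (h : Gnd T n) (hh : h ∈ Hnd T n v₀) :
    ∃ (S : Set V) (hS : ∀ g : T ≃g T, g v₀ = v₀ → ∀ v, g v ∈ S ↔ v ∈ S), S.Finite ∧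
      h ∈ levelSubgroup T (pointStab n) v₀ S hS := by
  let S : Set V := ⋃ v ∈ {v | h.left.1 v ∉ pointStab n}, {w | ∃ g : T ≃g T, g v₀ = v₀ ∧ g v = w}
  have hS1 : ∀ g : T ≃g T, g v₀ = v₀ → ∀ v, v ∈ S → g v ∈ S := by
    intro g hg v hv
    obtain ⟨u, hu, k, hk, rfl⟩ := Set.mem_iUnion₂.1 hv
    exact Set.mem_iUnion₂.2 ⟨u, hu, g * k, (congrArg g hk).trans hg, rfl⟩
  refine ⟨S, fun g hg v => ⟨fun hv => ?_, hS1 g hg v⟩,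
    Set.Finite.biUnion h.left.2 fun v _ => finite_orbit_stabilizer hT v₀ v, hh, fun v hv => ?_⟩
  · have := hS1 g⁻¹ (iso_inv_apply_eq.2 hg.symm) _ hv
    rwa [iso_inv_apply] at this
  · by_contra hcon
    exact hv (Set.mem_iUnion₂.2 ⟨v, hcon, 1, rfl, rfl⟩)

theorem levelSubgroup_le_Hnd {n : ℕ} [NeZero n] {v₀ : V} {S : Set V}
    (hS : ∀ g : T ≃g T, g v₀ = v₀ → ∀ v, g v ∈ S ↔ v ∈ S) :
    levelSubgroup T (pointStab n) v₀ S hS ≤ Hnd T n v₀ := fun _ hg => hg.1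

theorem isOpen_levelSubgroup_subgroupOf {n : ℕ} [NeZero n] {v₀ : V} {S : Set V}
    (hS : ∀ g : T ≃g T, g v₀ = v₀ → ∀ v, g v ∈ S ↔ v ∈ S) :
    IsOpen ((levelSubgroup T (pointStab n) v₀ S hS).subgroupOf (Hnd T n v₀) :
      Set (Hnd T n v₀)) :=
  (isOpen_levelSubgroup hS).preimage continuous_subtype_val

theorem isCompact_levelSubgroup_subgroupOf [T.LocallyFinite] (hT : T.Connected) {n : ℕ} [NeZero n]
    {v₀ : V} {S : Set V} (hSf : S.Finite)
    (hS : ∀ g : T ≃g T, g v₀ = v₀ → ∀ v, g v ∈ S ↔ v ∈ S) :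
    IsCompact ((levelSubgroup T (pointStab n) v₀ S hS).subgroupOf (Hnd T n v₀) :
      Set (Hnd T n v₀)) := by
  rw [Subtype.isCompact_iff]
  convert isCompact_levelSubgroup (A := pointStab n) hT hSf hS using 1
  ext g
  exact ⟨fun ⟨x, hx, hxg⟩ => hxg ▸ hx, fun hg => ⟨⟨g, hg.1⟩, hg, rfl⟩⟩

theorem invariant_empty (v₀ : V) :
    ∀ g : T ≃g T, g v₀ = v₀ → ∀ v, g v ∈ (∅ : Set V) ↔ v ∈ (∅ : Set V) := fun _ _ _ => Iff.rfl

variable {F F' : Subgroup (Equiv.Perm Ω)} {n : ℕ} [NeZero n] (c : LegalColoring T Ω)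

theorem stabilizerEmbedding_injective (v₀ : V) (b : Fin n ≃ F' ⧸ F.subgroupOf F')
    (hb : b 0 = ((1 : F') : F' ⧸ F.subgroupOf F')) :
    Function.Injective (stabilizerEmbedding c v₀ b hb) := fun _ _ h =>
  Subtype.ext (Subtype.ext (congrArg (fun g : Hnd T n v₀ => g.1.right) h))

theorem range_stabilizerEmbedding (v₀ : V) (b : Fin n ≃ F' ⧸ F.subgroupOf F')
    (hb : b 0 = ((1 : F') : F' ⧸ F.subgroupOf F')) :
    (stabilizerEmbedding c v₀ b hb).range = (embedding c b hb).range.subgroupOf (Hnd T n v₀) := by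
  ext ⟨h, hh⟩
  rw [Subgroup.mem_subgroupOf]
  constructor
  · rintro ⟨γ, hγ⟩
    exact ⟨γ.1, congrArg Subtype.val hγ⟩
  · rintro ⟨γ, rfl⟩
    exact ⟨⟨γ, hh⟩, rfl⟩

/-- An element `(ρ_γ, γ)` of the image that lies in the basic neighbourhood of `1` given by `v₀`
and its neighbours has its local permutations in `F`, since `ρ_γ` takes its values in `𝔖_{n-1}`,
and `γ` fixes `v₀` and its neighbours. -/
theorem discreteTopology_range [Finite Ω] (hT : T.IsTree) (hF : IsSemiregular F) (v₀ : V)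
    (b : Fin n ≃ F' ⧸ F.subgroupOf F') (hb : b 0 = ((1 : F') : F' ⧸ F.subgroupOf F')) :
    DiscreteTopology (stabilizerEmbedding c v₀ b hb).range := by
  let I : Set V := insert v₀ (Set.range (c.next v₀))
  have hU : basicNhd (1 : Gnd T n) I ∈ nhds (1 : Gnd T n) :=
    (nhds_wreath_hasBasis 1).mem_of_mem ((Set.finite_range _).insert _)
  rw [discreteTopology_iff_isOpen_singleton_one]
  have hU' : (fun x : (stabilizerEmbedding c v₀ b hb).range => (x.1.1 : Gnd T n)) ⁻¹'
      basicNhd 1 I ∈ nhds (1 : (stabilizerEmbedding c v₀ b hb).range) :=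
    (continuous_subtype_val.comp continuous_subtype_val).continuousAt.preimage_mem_nhds hU
  refine isOpen_iff_mem_nhds.2 fun x hx => ?_
  obtain rfl : x = 1 := hx
  refine Filter.mem_of_superset hU' ?_
  rintro ⟨_, γ, rfl⟩ ⟨hA, -, hI⟩
  have hloc : ∀ v, localPerm c γ.1.1 v ∈ F := by
    intro v
    have h2 : (1 : Equiv.Perm (Fin n))⁻¹ * twist c b γ.1 (γ.1.1 v) ∈ pointStab n := hA (γ.1.1 v)
    rw [inv_one, one_mul] at h2
    have h3 := (cosetAction_mem_pointStab b hb _).1 h2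
    change localPerm c γ.1.1 (γ.1.1⁻¹ (γ.1.1 v)) ∈ F at h3
    rwa [iso_inv_apply] at h3
  have h4 : γ.1.1 = 1 := eq_one_of_localPerm_mem c hT hF hloc γ.2
    fun a => hI _ (Or.inr ⟨a, rfl⟩)
  have h5 : γ = 1 := Subtype.ext (Subtype.ext h4)
  exact Subtype.ext (h5 ▸ map_one _)

/-- `H_{n,d}` is the product of the compact open subgroup `𝔖_{n-1}^V ⋊ K_d` and of the image of
`K(F,F')`: the product of `(f, k)` by `(ρ_γ, γ)` is in the former if and only if
`f (k w) α(σ(γ⁻¹, w))⁻¹` fixes `0` for all `w`, a condition that determines `σ(γ⁻¹, w)`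
modulo `F`. -/
theorem exists_mul_mem_levelSubgroup (hT : T.IsTree) (hFF' : F ≤ F') (horb : PreservesOrbits F F')
    (v₀ : V) (b : Fin n ≃ F' ⧸ F.subgroupOf F')
    (hb : b 0 = ((1 : F') : F' ⧸ F.subgroupOf F')) (h : Hnd T n v₀) :
    ∃ γ ∈ (stabilizerEmbedding c v₀ b hb).range,
      h * γ ∈ (levelSubgroup T (pointStab n) v₀ ∅ (invariant_empty v₀)).subgroupOf
        (Hnd T n v₀) := by
  obtain ⟨⟨f, k⟩, hk⟩ := h
  have hex : ∀ w, ∃ x : F', (x : F' ⧸ F.subgroupOf F') = b ((f.1 (k w))⁻¹ 0) :=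
    fun w => QuotientGroup.mk_surjective _
  choose x hx using hex
  obtain ⟨δ, hδ0, hδ⟩ := exists_iso_localPerm c hT v₀ hFF' horb x
  have hδmem : δ ∈ almostPrescribed c F F' := by
    refine ⟨fun v => (hδ v).1, (f.2.preimage k.injective.injOn).subset fun v hv hmem => hv ?_⟩
    have h1 : (x v : Equiv.Perm Ω) ∈ F := by
      have h2 : (f.1 (k v))⁻¹ 0 = 0 := (pointStab n).inv_mem hmem
      have h3 := hx v
      rw [h2, hb, eq_comm, QuotientGroup.eq, inv_one, one_mul] at h3
      exact h3
    exact (F.mul_mem_cancel_right h1).1 (hδ v).2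
  let γ : vertexStabilizer c v₀ F F' := ⟨⟨δ, hδmem⟩⁻¹, (vertexStabilizer c v₀ F F').inv_mem hδ0⟩
  refine ⟨_, ⟨γ, rfl⟩, ?_⟩
  rw [Subgroup.mem_subgroupOf]
  refine ⟨((Hnd T n v₀).mul_mem hk (stabilizerEmbedding c v₀ b hb γ).2), fun v _ => ?_⟩
  obtain ⟨w, rfl⟩ := k.surjective v
  change f.1 (k w) * twist c b γ.1 (k⁻¹ (k w)) ∈ pointStab n
  rw [iso_inv_apply]
  have h1 : localPerm c γ.1.1 (γ.1.1⁻¹ w) = (localPerm c δ w)⁻¹ := by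
    change localPerm c δ⁻¹ (δ⁻¹⁻¹ w) = _
    rw [inv_inv, localPerm_inv, iso_inv_apply]
  have h2 : twist c b γ.1 w = cosetAction b (⟨localPerm c δ w, (hδ w).1⟩⁻¹ : F') :=
    congrArg (cosetAction b) (Subtype.ext h1)
  have h3 : twist c b γ.1 w 0 = (f.1 (k w))⁻¹ 0 := by
    rw [h2, cosetAction_apply, Equiv.symm_apply_eq, ← hx, hb, MulAction.Quotient.smul_coe,
      smul_eq_mul, mul_one, QuotientGroup.eq, inv_inv]
    exact (hδ w).2
  change (f.1 (k w)) (twist c b γ.1 w 0) = 0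
  rw [h3]
  exact (f.1 (k w)).apply_symm_apply 0

end Main

end TreeLattice

theorem proposition3p1 {V Ω : Type*} [Fintype Ω] (d n : ℕ) [NeZero n] (hd : 3 ≤ d)
    (hΩ : Fintype.card Ω = d)
    (T : SimpleGraph V) [T.LocallyFinite] (hT : T.IsTree) (hreg : T.IsRegularOfDegree d)
    (c : TreeLattice.LegalColoring T Ω) (v₀ : V)
    (F F' : Subgroup (Equiv.Perm Ω)) (hFF' : F ≤ F')
    (horb : TreeLattice.PreservesOrbits F F') (hF : TreeLattice.IsSemiregular F)
    (hn : F.relIndex F' = n) :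
    -- `H_{n,d}` is a locally compact group, open in `G_{n,d}`
    (IsTopologicalGroup (TreeLattice.Hnd T n v₀) ∧
      LocallyCompactSpace (TreeLattice.Hnd T n v₀) ∧
      T2Space (TreeLattice.Hnd T n v₀) ∧
      IsOpen (TreeLattice.Hnd T n v₀ : Set (TreeLattice.Gnd T n))) ∧
    -- there are bijections between `{0, …, n-1}` and `F' ⧸ F` that send `0` to the class `F`
    (∃ b : Fin n ≃ F' ⧸ F.subgroupOf F', b 0 = ((1 : F') : F' ⧸ F.subgroupOf F')) ∧
    -- each of them gives an embedding of `K(F,F')` in `H_{n,d}` as a cocompact lattice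
    ∀ (b : Fin n ≃ F' ⧸ F.subgroupOf F') (hb : b 0 = ((1 : F') : F' ⧸ F.subgroupOf F')),
      Function.Injective (TreeLattice.stabilizerEmbedding c v₀ b hb) ∧
      TreeLattice.IsCocompactLattice (TreeLattice.stabilizerEmbedding c v₀ b hb).range ∧
      (TreeLattice.stabilizerEmbedding c v₀ b hb).range =
        (TreeLattice.embedding c b hb).range.subgroupOf (TreeLattice.Hnd T n v₀) := by
  have hlc : LocallyCompactSpace (TreeLattice.Hnd T n v₀) :=
    (TreeLattice.isCompact_levelSubgroup_subgroupOf hT.connected Set.finite_empty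
      (TreeLattice.invariant_empty v₀)).locallyCompactSpace_of_mem_nhds_of_group
      ((TreeLattice.isOpen_levelSubgroup_subgroupOf _).mem_nhds (Subgroup.one_mem _))
  refine ⟨⟨inferInstance, hlc, inferInstance, ?_⟩, TreeLattice.exists_equiv_quotient hn,
    fun b hb => ⟨TreeLattice.stabilizerEmbedding_injective c v₀ b hb, ?_,
      TreeLattice.range_stabilizerEmbedding c v₀ b hb⟩⟩
  · exact Subgroup.isOpen_mono (TreeLattice.levelSubgroup_le_Hnd (TreeLattice.invariant_empty v₀))
      (TreeLattice.isOpen_levelSubgroup _)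
  · refine TreeLattice.isCocompactLattice_of_mul_eq_univ _ _
      (TreeLattice.isOpen_levelSubgroup_subgroupOf (TreeLattice.invariant_empty v₀))
      (TreeLattice.isCompact_levelSubgroup_subgroupOf hT.connected Set.finite_empty _)
      (TreeLattice.discreteTopology_range c hT hF v₀ b hb)
      (TreeLattice.exists_mul_mem_levelSubgroup c hT hFF' horb v₀ b hb) fun g => ?_
    obtain ⟨S, hS, hSf, hg⟩ := TreeLattice.exists_levelSubgroup_mem hT.connected g.1 g.2
    exact ⟨_, TreeLattice.isOpen_levelSubgroup_subgroupOf hS,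
      TreeLattice.isCompact_levelSubgroup_subgroupOf hT.connected hSf hS, hg⟩
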